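/- Theorem 4.1. Let $p\in C^1[0,\infty)$ satisfy $p(\rho)\ge 0$ for $\rho\ge 0$, $p'(\rho)>0$ for $\rho>0$, $\int_0^1 p(\rho)\rho^{-2}\,d\rho<\infty$ and $\lim_{\rho\to\infty}p(\rho)/\rho^{\gamma}=K$ for some constants $0<K<\infty$ and $\gamma\ge 4/3$. Then there is a constant $\mathfrak M_c$ (depending only on $p$), with $0<\mathfrak M_c<\infty$ if $\gamma=4/3$ and $\mathfrak M_c=\infty$ if $\gamma>4/3$, such that the following holds for every $0<M<\mathfrak M_c$ and every function $L$ (the square of the prescribed angular momentum per unit mass) with $L\ge 0$ on $[0,M]$. For $x\in\mathbb R^3$ write $r(x)=\sqrt{x_1^2+x_2^2}$, and set $$A(\rho)=\rho\int_0^\rho\frac{p(s)}{s^2}\,ds,\qquad B\rho(x)=\int_{\mathbb R^3}\frac{\rho(y)}{|x-y|}\,dy,\qquad m_\rho(r)=\int_{\{x:\,r(x)<r\}}\rho(x)\,dx .$$ Let $W_M$ be the set of integrable functions $\rho:\mathbb R^3\to\mathbb R$ that are axisymmetric (functions of $r(x)$ and $x_3$ only, up to null sets), satisfy $\rho\ge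 0$ a.e. and $\int_{\mathbb R^3}\rho\,dx=M$, and for which $$\int_{\mathbb R^3}\Big(A(\rho(x))+\frac{\rho(x)L(m_\rho(r(x)))}{r(x)^2}+\rho(x)B\rho(x)\Big)dx<\infty .$$ For $\rho\in W_M$ let $$F(\rho)=\int_{\mathbb R^3}\Big[A(\rho(x))+\frac12\frac{\rho(x)L(m_\rho(r(x)))}{r(x)^2}-\frac12\rho(x)B\rho(x)\Big]dx .$$ Then there are positive constants $C_1,C_2$ such that for all $\rho\in W_M$ the integrals below and in the definition of $F(\rho)$ converge absolutely and $$\int_{\mathbb R^3}\Big[A(\rho(x))+\frac12\frac{\rho(x)L(m_\rho(r(x)))}{r(x)^2}\Big]dx\le C_1F(\rho)+C_2 .$$ -/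

import Mathlib

open MeasureTheory Set Filter Topology

noncomputable section

namespace RotatingStar

/-- Physical space `ℝ³` with the Euclidean norm and Lebesgue measure. -/
abbrev Space : Type := EuclideanSpace ℝ (Fin 3)

/-- Distance `r(x) = √(x₁² + x₂²)` to the axis of rotation. -/
def cylRadius (x : Space) : ℝ := Real.sqrt (x 0 ^ 2 + x 1 ^ 2)

/-- Height `z(x) = x₃` along the axis of rotation. -/
def height (x : Space) : ℝ := x 2

/-- The hypotheses on the pressure function `p : [0, ∞) → ℝ` (values at negative arguments are
irrelevant): `p ∈ C¹[0, ∞)`, `∫₀¹ p(s)/s² ds < ∞`, `p(s)/s^γ → K` as `s → ∞` with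
`0 < K < ∞` and `γ ≥ 4/3`, `p ≥ 0`, and `p' > 0` on `(0, ∞)`. -/
structure PressureLaw (p : ℝ → ℝ) (γ K : ℝ) : Prop where
  four_thirds_le : 4 / 3 ≤ γ
  K_pos : 0 < K
  contDiffOn : ContDiffOn ℝ 1 p (Ici 0)
  integrableOn : IntegrableOn (fun s => p s / s ^ 2) (Ioc 0 1)
  tendsto : Tendsto (fun s => p s / s ^ γ) atTop (𝓝 K)
  nonneg : ∀ s, 0 ≤ s → 0 ≤ p s
  deriv_pos : ∀ s, 0 < s → 0 < deriv p s

/-- `A(ρ) = ρ ∫₀^ρ p(s)/s² ds`. -/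
def enthalpy (p : ℝ → ℝ) (t : ℝ) : ℝ := t * ∫ s in (0 : ℝ)..t, p s / s ^ 2

/-- `B ρ(x) = ∫ ρ(y)/|x - y| dy`. For `ρ ∈ L¹(ℝ³)` the integral converges for almost every `x`. -/
def newton (ρ : Space → ℝ) (x : Space) : ℝ := ∫ y, ρ y / ‖x - y‖

/-- `m_ρ(r)`: the mass in the cylinder of radius `r` around the axis of rotation. -/
def cylMass (ρ : Space → ℝ) (r : ℝ) : ℝ := ∫ x in {x : Space | cylRadius x < r}, ρ x

/-- The density `ρ(x) L(m_ρ(r(x))) / r(x)²`, that is, twice the density of rotational energy. -/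
def rotDensity (L : ℝ → ℝ) (ρ : Space → ℝ) (x : Space) : ℝ :=
  ρ x * L (cylMass ρ (cylRadius x)) / cylRadius x ^ 2

/-- `ρ` is (up to a null set) a function of `r(x)` and `z(x)` only. -/
def IsAxisymmetric (ρ : Space → ℝ) : Prop :=
  ∃ g : ℝ → ℝ → ℝ, ∀ᵐ x : Space, ρ x = g (cylRadius x) (height x)

/-- The admissible class `W_M` for the pressure `p` and the squared angular momentum `L`. The last
integrand is nonnegative, so that finiteness of its integral is integrability. -/
structure Admissible (p L : ℝ → ℝ) (M : ℝ) (ρ : Space → ℝ) : Prop where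
  axisymmetric : IsAxisymmetric ρ
  nonneg : ∀ᵐ x : Space, 0 ≤ ρ x
  integrable : Integrable ρ
  mass : ∫ x, ρ x = M
  finite_energy :
    Integrable fun x => enthalpy p (ρ x) + rotDensity L ρ x + ρ x * newton ρ x

/-- The integrand `A(ρ) + ½ ρ L(m_ρ)/r²` (potential plus rotational energy). -/
def positiveDensity (p L : ℝ → ℝ) (ρ : Space → ℝ) (x : Space) : ℝ :=
  enthalpy p (ρ x) + 1 / 2 * rotDensity L ρ x

/-- The integrand `A(ρ) + ½ ρ L(m_ρ)/r² - ½ ρ Bρ` of the energy functional. -/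
def energyDensity (p L : ℝ → ℝ) (ρ : Space → ℝ) (x : Space) : ℝ :=
  enthalpy p (ρ x) + 1 / 2 * rotDensity L ρ x - 1 / 2 * (ρ x * newton ρ x)

/-- The energy functional `F(ρ) = ∫ [A(ρ) + ½ ρ L(m_ρ)/r² - ½ ρ Bρ] dx`. -/
def energy (p L : ℝ → ℝ) (ρ : Space → ℝ) : ℝ := ∫ x, energyDensity p L ρ x

end RotatingStar

end

/-!
The gravitational energy is the only negative part of `F`, and it is controlled by the potential
energy `∫ A(ρ)`. The bound on gravity is

  `∫ ρ Bρ ≤ 2 (2π + 1) M^(2/3) ∫ ρ^(4/3)`   (`integral_mul_newton_le`),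

proved without the Hardy–Littlewood–Sobolev inequality. Up to a factor `2` one may replace
`ρ(x) ρ(y)` by `ρ(x) min(ρ(x), ρ(y))`, and the potential at `x` of the truncated density
`min(ρ(x), ρ)` is at most `2πR² ρ(x) + M / R` for every `R > 0`; the choice
`R = (M / ρ(x))^(1/3)` gives `(2π + 1) M^(2/3) ρ(x)^(1/3)`.

On the other side, if `p s ≥ k s^(4/3)` for `s ≥ S`, then `A(t) + 3k S^(1/3) t ≥ 3k t^(4/3)` for all
`t ≥ 0` (`PressureLaw.le_enthalpy`). So if `2 (2π + 1) M^(2/3) ≤ 3k`, half of `∫ ρ Bρ` is at most half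
of `∫ A(ρ)` up to a constant, and the estimate holds with `C₁ = 2`
(`Admissible.integral_positiveDensity_le`). For `γ > 4/3` every `k` is allowed, hence every mass; for
`γ = 4/3` every `k < K` is allowed, which yields a positive critical mass.
-/

namespace RotatingStar

/-! ### The Coulomb energy and the `L^(4/3)` norm -/

/-- The Newtonian kernel has integral `2πR²` over a ball of radius `R` around its singularity. -/
theorem lintegral_ball_inv_norm_sub (x : Space) {R : ℝ} (hR : 0 < R) :
    ∫⁻ y in Metric.ball x R, ENNReal.ofReal ‖x - y‖⁻¹ = ENNReal.ofReal (2 * Real.pi * R ^ 2) := by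
  set g : ℝ → ℝ := (Iio R).indicator (fun r => r⁻¹) with hg
  have hdim : Module.finrank ℝ Space = 3 := by simp
  have hball : (volume : Measure Space).real (Metric.ball 0 1) = Real.pi * 4 / 3 := by
    rw [Measure.real, EuclideanSpace.volume_ball_fin_three]
    simp only [one_pow, ENNReal.ofReal_one, one_mul]
    exact ENNReal.toReal_ofReal (by positivity)
  have heq : ∀ r ∈ Ioi (0 : ℝ), r ^ (3 - 1) • g r = (Ioo 0 R).indicator (fun r => r) r := by
    intro r hr
    have hr0 : r ≠ 0 := (ne_of_gt hr)
    rw [mem_Ioi] at hr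
    by_cases h : r < R
    · simp [hg, h, hr]
      field_simp
    · simp [hg, h]
  have hid : IntegrableOn (fun r : ℝ => r) (Ioo 0 R) :=
    (continuous_id.integrableOn_Icc (a := (0 : ℝ)) (b := R)).mono_set Ioo_subset_Icc_self
  have hint : Integrable (fun y : Space => g ‖y‖) := by
    rw [integrable_fun_norm_addHaar, hdim, integrableOn_congr_fun heq measurableSet_Ioi]
    exact ((integrable_indicator_iff measurableSet_Ioo).2 hid).integrableOn
  have hg0 : ∀ r, 0 ≤ r → 0 ≤ g r := fun r hr =>
    indicator_apply_nonneg fun _ => inv_nonneg.2 hr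
  calc ∫⁻ y in Metric.ball x R, ENNReal.ofReal ‖x - y‖⁻¹
      = ∫⁻ y, ENNReal.ofReal (g ‖x - y‖) := by
        rw [← lintegral_indicator Metric.isOpen_ball.measurableSet]
        refine lintegral_congr fun y => ?_
        by_cases h : ‖x - y‖ < R
        · have : y ∈ Metric.ball x R := by rwa [mem_ball_iff_norm']
          simp [hg, h, this]
        · have : y ∉ Metric.ball x R := by rwa [mem_ball_iff_norm']
          simp [hg, h, this]
    _ = ∫⁻ y : Space, ENNReal.ofReal (g ‖y‖) :=
        lintegral_sub_left_eq_self (fun y : Space => ENNReal.ofReal (g ‖y‖)) x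
    _ = ENNReal.ofReal (∫ y : Space, g ‖y‖) :=
        (ofReal_integral_eq_lintegral_ofReal hint
          (Eventually.of_forall fun y => hg0 _ (norm_nonneg y))).symm
    _ = ENNReal.ofReal (2 * Real.pi * R ^ 2) := by
        congr 1
        rw [integral_fun_norm_addHaar, hdim, hball, setIntegral_congr_fun measurableSet_Ioi heq,
          setIntegral_indicator measurableSet_Ioo, inter_eq_self_of_subset_right Ioo_subset_Ioi_self,
          ← integral_Ioc_eq_integral_Ioo, ← intervalIntegral.integral_of_le hR.le, integral_id]
        simp only [nsmul_eq_mul, smul_eq_mul]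
        push_cast
        ring

/-- The potential of `ρ` truncated at height `t`: inside the ball of radius `R` around `x` the density
is at most `t`, outside it the kernel is at most `R⁻¹`. -/
theorem lintegral_min_mul_inv_norm_sub_le (ρ : Space → ℝ) (x : Space) {t R : ℝ} (ht : 0 ≤ t)
    (hR : 0 < R) :
    ∫⁻ y, min (ENNReal.ofReal t) (ENNReal.ofReal (ρ y)) * ENNReal.ofReal ‖x - y‖⁻¹
      ≤ ENNReal.ofReal (t * (2 * Real.pi * R ^ 2))
        + (∫⁻ y, ENNReal.ofReal (ρ y)) * ENNReal.ofReal R⁻¹ := by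
  have hm : Measurable fun y : Space => ENNReal.ofReal ‖x - y‖⁻¹ := by fun_prop
  rw [← lintegral_add_compl _ (Metric.isOpen_ball (x := x) (ε := R)).measurableSet]
  gcongr ?_ + ?_
  · calc _ ≤ ∫⁻ y in Metric.ball x R, ENNReal.ofReal t * ENNReal.ofReal ‖x - y‖⁻¹ := by
          gcongr
          exact min_le_left _ _
      _ = _ := by
          rw [lintegral_const_mul _ hm, lintegral_ball_inv_norm_sub x hR, ENNReal.ofReal_mul ht]
  · calc _ ≤ ∫⁻ y in (Metric.ball x R)ᶜ, ENNReal.ofReal (ρ y) * ENNReal.ofReal R⁻¹ := by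
          refine setLIntegral_mono' Metric.isOpen_ball.measurableSet.compl fun y hy => ?_
          rw [mem_compl_iff, mem_ball_iff_norm', not_lt] at hy
          gcongr
          exact min_le_right _ _
      _ ≤ ∫⁻ y, ENNReal.ofReal (ρ y) * ENNReal.ofReal R⁻¹ := setLIntegral_le_lintegral _ _
      _ = _ := lintegral_mul_const' _ _ ENNReal.ofReal_ne_top

/-- The bound on the truncated potential with the best order of the radius, times the height. -/
theorem ofReal_mul_lintegral_min_le {ρ : Space → ℝ} {M : ℝ} (hM : 0 < M)
    (hmass : ∫⁻ y, ENNReal.ofReal (ρ y) = ENNReal.ofReal M) (x : Space) {t : ℝ} (ht : 0 ≤ t) :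
    ENNReal.ofReal t *
        ∫⁻ y, min (ENNReal.ofReal t) (ENNReal.ofReal (ρ y)) * ENNReal.ofReal ‖x - y‖⁻¹
      ≤ ENNReal.ofReal ((2 * Real.pi + 1) * M ^ (2 / 3 : ℝ)) *
        ENNReal.ofReal (t ^ (4 / 3 : ℝ)) := by
  rcases ht.eq_or_lt with rfl | ht0
  · simp
  set m : ℝ := M ^ (1 / 3 : ℝ) with hm
  set s : ℝ := t ^ (1 / 3 : ℝ) with hs
  have hm0 : 0 < m := Real.rpow_pos_of_pos hM _
  have hs0 : 0 < s := Real.rpow_pos_of_pos ht0 _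
  have hm3 : M = m ^ 3 := by
    rw [hm, ← Real.rpow_natCast, ← Real.rpow_mul hM.le]; norm_num
  have hs3 : t = s ^ 3 := by
    rw [hs, ← Real.rpow_natCast, ← Real.rpow_mul ht]; norm_num
  have hm2 : M ^ (2 / 3 : ℝ) = m ^ 2 := by
    rw [hm, ← Real.rpow_natCast, ← Real.rpow_mul hM.le]; norm_num
  have hs4 : t ^ (4 / 3 : ℝ) = s ^ 4 := by
    rw [hs, ← Real.rpow_natCast, ← Real.rpow_mul ht]; norm_num
  have hpi := Real.pi_pos
  -- The radius `(M / t) ^ (1 / 3)`, at which the near and the far contribution balance.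
  have hR : 0 < m / s := by positivity
  calc _ ≤ ENNReal.ofReal t * (ENNReal.ofReal (t * (2 * Real.pi * (m / s) ^ 2))
        + ENNReal.ofReal M * ENNReal.ofReal (m / s)⁻¹) := by
        rw [← hmass]
        gcongr
        exact lintegral_min_mul_inv_norm_sub_le ρ x ht hR
    _ = ENNReal.ofReal (t * (t * (2 * Real.pi * (m / s) ^ 2) + M * (m / s)⁻¹)) := by
        rw [ENNReal.ofReal_mul (p := t) (q := _ + _) ht,
          ENNReal.ofReal_add (by positivity) (by positivity), ENNReal.ofReal_mul (p := M) hM.le]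
    _ = _ := by
        rw [← ENNReal.ofReal_mul (by positivity), hm2, hs4]
        congr 1
        rw [hm3, hs3]
        field_simp

/-- The Coulomb energy bound `∫∫ ρ(x) ρ(y) / |x - y| ≤ C M^(2/3) ∫ ρ^(4/3)`. As
`ρ(x) ρ(y) ≤ (ρ(x) + ρ(y)) min(ρ(x), ρ(y))`, symmetry bounds the left side by
`2 ∫ ρ(x) ∫ min(ρ(x), ρ(y)) / |x - y|`, whose inner integral is the potential of `ρ` truncated at
the height `ρ(x)`. -/
theorem lintegral_ofReal_mul_lintegral_inv_norm_sub_le {ρ : Space → ℝ} (hρ : AEMeasurable ρ)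
    {M : ℝ} (hM : 0 < M) (hmass : ∫⁻ y, ENNReal.ofReal (ρ y) = ENNReal.ofReal M) :
    ∫⁻ x, ENNReal.ofReal (ρ x) * ∫⁻ y, ENNReal.ofReal (ρ y) * ENNReal.ofReal ‖x - y‖⁻¹
      ≤ ENNReal.ofReal (2 * (2 * Real.pi + 1) * M ^ (2 / 3 : ℝ)) *
        ∫⁻ x, ENNReal.ofReal (max (ρ x) 0 ^ (4 / 3 : ℝ)) := by
  set f : Space → ENNReal := fun x => ENNReal.ofReal (ρ x) with hf
  set k : Space → Space → ENNReal := fun x y => ENNReal.ofReal ‖x - y‖⁻¹ with hk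
  have hfm : AEMeasurable f := hρ.ennreal_ofReal
  have hkm : Measurable fun z : Space × Space => k z.1 z.2 := by simp only [hk]; fun_prop
  have hf1 : AEMeasurable (fun z : Space × Space => f z.1) (volume.prod volume) := hfm.comp_fst
  have hf2 : AEMeasurable (fun z : Space × Space => f z.2) (volume.prod volume) := hfm.comp_snd
  have hmin : ∀ a b : ENNReal, a * b ≤ a * min a b + b * min a b := by
    intro a b
    rcases le_total a b with h | h
    · rw [min_eq_left h, mul_comm a b]; exact le_add_self
    · rw [min_eq_right h]; exact le_self_add
  have hG : AEMeasurable (Function.uncurry fun x y : Space => f x * (min (f x) (f y) * k x y))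
      (volume.prod volume) := hf1.mul ((hf1.min hf2).mul hkm.aemeasurable)
  have hswap : ∫⁻ x, ∫⁻ y, f y * (min (f x) (f y) * k x y)
      = ∫⁻ x, ∫⁻ y, f x * (min (f x) (f y) * k x y) := by
    rw [lintegral_lintegral_swap hG]
    refine lintegral_congr fun x => lintegral_congr fun y => ?_
    simp only [hk]
    rw [min_comm, norm_sub_rev]
  calc ∫⁻ x, f x * ∫⁻ y, f y * k x y
      = ∫⁻ x, ∫⁻ y, f x * (f y * k x y) := by
        refine lintegral_congr fun x => ?_
        rw [lintegral_const_mul' _ _ ENNReal.ofReal_ne_top]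
    _ ≤ ∫⁻ x, ∫⁻ y, (f x * (min (f x) (f y) * k x y) + f y * (min (f x) (f y) * k x y)) := by
        refine lintegral_mono fun x => lintegral_mono fun y => ?_
        simp only [← mul_assoc, ← add_mul]
        rw [add_mul]
        gcongr
        exact hmin _ _
    _ = (∫⁻ x, ∫⁻ y, f x * (min (f x) (f y) * k x y))
          + ∫⁻ x, ∫⁻ y, f y * (min (f x) (f y) * k x y) := by
        refine Eq.trans ?_ (lintegral_add_left' hG.lintegral_prod_right' _)
        refine lintegral_congr_ae ?_
        filter_upwards with x
        refine lintegral_add_left' ?_ _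
        exact ((aemeasurable_const.min hfm).mul (by simp only [hk]; fun_prop)).const_mul _
    _ = 2 * ∫⁻ x, f x * ∫⁻ y, min (f x) (f y) * k x y := by
        rw [hswap, two_mul]
        simp_rw [lintegral_const_mul' _ _ (show ∀ {x}, f x ≠ ⊤ from ENNReal.ofReal_ne_top)]
    _ ≤ 2 * ∫⁻ x, ENNReal.ofReal ((2 * Real.pi + 1) * M ^ (2 / 3 : ℝ)) *
          ENNReal.ofReal (max (ρ x) 0 ^ (4 / 3 : ℝ)) := by
        refine mul_le_mul_right (lintegral_mono fun x => ?_) 2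
        have hmax : f x = ENNReal.ofReal (max (ρ x) 0) := by simp [hf]
        rw [hmax]
        exact ofReal_mul_lintegral_min_le hM hmass x (le_max_right _ _)
    _ = _ := by
        rw [lintegral_const_mul' _ _ ENNReal.ofReal_ne_top, ← mul_assoc]
        congr 1
        rw [mul_assoc 2, ENNReal.ofReal_mul zero_le_two, ENNReal.ofReal_ofNat]

/-! ### Lower bounds for the enthalpy -/

theorem PressureLaw.intervalIntegrable {p : ℝ → ℝ} {γ K : ℝ} (hp : PressureLaw p γ K) {t : ℝ}
    (ht : 0 ≤ t) : IntervalIntegrable (fun s => p s / s ^ 2) volume 0 t := by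
  have h01 : IntervalIntegrable (fun s => p s / s ^ 2) volume 0 1 :=
    (intervalIntegrable_iff_integrableOn_Ioc_of_le zero_le_one).2 hp.integrableOn
  have h1 : ∀ u, 1 ≤ u → IntervalIntegrable (fun s => p s / s ^ 2) volume 1 u := by
    intro u hu
    refine ContinuousOn.intervalIntegrable_of_Icc hu ?_
    refine (hp.contDiffOn.continuousOn.mono fun s hs => ?_).div (by fun_prop) fun s hs => ?_
    · exact zero_le_one.trans hs.1
    · have : 0 < s := zero_lt_one.trans_le hs.1
      positivity
  rcases le_total t 1 with h | h
  · refine h01.mono_set ?_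
    rw [uIcc_of_le ht, uIcc_of_le zero_le_one]
    exact Icc_subset_Icc_right h
  · exact h01.trans (h1 t h)

theorem PressureLaw.div_sq_nonneg {p : ℝ → ℝ} {γ K : ℝ} (hp : PressureLaw p γ K) {s : ℝ}
    (hs : 0 ≤ s) : 0 ≤ p s / s ^ 2 :=
  div_nonneg (hp.nonneg s hs) (sq_nonneg s)

theorem PressureLaw.enthalpy_nonneg {p : ℝ → ℝ} {γ K : ℝ} (hp : PressureLaw p γ K) {t : ℝ}
    (ht : 0 ≤ t) : 0 ≤ enthalpy p t :=
  mul_nonneg ht (intervalIntegral.integral_nonneg ht fun _ hs => hp.div_sq_nonneg hs.1)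

theorem PressureLaw.integral_mono {p : ℝ → ℝ} {γ K : ℝ} (hp : PressureLaw p γ K) {r s t : ℝ}
    (hr : 0 ≤ r) (hrs : r ≤ s) (hst : s ≤ t) :
    ∫ u in r..s, p u / u ^ 2 ≤ ∫ u in (0 : ℝ)..t, p u / u ^ 2 :=
  intervalIntegral.integral_mono_interval hr hrs hst
    ((ae_restrict_iff' measurableSet_Ioc).2
      (Eventually.of_forall fun _ hu => hp.div_sq_nonneg hu.1.le))
    (hp.intervalIntegrable (hr.trans (hrs.trans hst)))

theorem PressureLaw.enthalpy_monotoneOn {p : ℝ → ℝ} {γ K : ℝ} (hp : PressureLaw p γ K) :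
    MonotoneOn (enthalpy p) (Ici 0) := fun _ hs _ ht hst =>
  mul_le_mul hst (hp.integral_mono le_rfl hs hst)
    (intervalIntegral.integral_nonneg hs fun _ hu => hp.div_sq_nonneg hu.1) ht

/-- Integrating `p s / s² ≥ k s^(-2/3)` over `[S, t]`; the second term on the right absorbs the lower
limit, and makes the bound trivial for `t ≤ S`. -/
theorem PressureLaw.le_enthalpy {p : ℝ → ℝ} {γ K : ℝ} (hp : PressureLaw p γ K) {k S : ℝ}
    (hk : 0 ≤ k) (hS : 0 < S) (hpk : ∀ s, S ≤ s → k * s ^ (4 / 3 : ℝ) ≤ p s) {t : ℝ}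
    (ht : 0 ≤ t) :
    3 * k * t ^ (4 / 3 : ℝ) ≤ enthalpy p t + 3 * k * S ^ (1 / 3 : ℝ) * t := by
  have hsplit : t ^ (4 / 3 : ℝ) = t * t ^ (1 / 3 : ℝ) := by
    rw [show (4 / 3 : ℝ) = 1 + 1 / 3 by norm_num, Real.rpow_add' ht (by norm_num), Real.rpow_one]
  rcases le_total t S with h | h
  · have h1 : t ^ (1 / 3 : ℝ) ≤ S ^ (1 / 3 : ℝ) := Real.rpow_le_rpow ht h (by norm_num)
    have h2 : 3 * k * (t * t ^ (1 / 3 : ℝ)) ≤ 3 * k * (t * S ^ (1 / 3 : ℝ)) := by gcongr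
    rw [hsplit]
    linarith [hp.enthalpy_nonneg ht]
  · have h0 : (0 : ℝ) ∉ uIcc S t := by
      rw [uIcc_of_le h]; exact fun hm => (hS.trans_le hm.1).false
    have hI : ∫ s in S..t, k * s ^ (-(2 / 3) : ℝ)
        = 3 * k * (t ^ (1 / 3 : ℝ) - S ^ (1 / 3 : ℝ)) := by
      rw [intervalIntegral.integral_const_mul, integral_rpow (Or.inl (by norm_num))]
      norm_num
      ring
    have hle : ∫ s in S..t, k * s ^ (-(2 / 3) : ℝ) ≤ ∫ s in S..t, p s / s ^ 2 := by
      refine intervalIntegral.integral_mono_on h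
        ((intervalIntegral.intervalIntegrable_rpow (Or.inr h0)).const_mul k)
        ((hp.intervalIntegrable ht).mono_set ?_) fun s hs => ?_
      · rw [uIcc_of_le h, uIcc_of_le ht]
        exact Icc_subset_Icc_left hS.le
      · have hs0 : 0 < s := hS.trans_le hs.1
        rw [le_div_iff₀ (by positivity), mul_assoc, ← Real.rpow_two, ← Real.rpow_add hs0]
        norm_num
        exact hpk s hs.1
    have := mul_le_mul_of_nonneg_left (hI ▸ hle.trans (hp.integral_mono hS.le h le_rfl)) ht
    rw [hsplit]
    unfold enthalpy
    linarith

/-- Near infinity `p` is above `k s^(4/3)`, for every `k < K` if `γ = 4/3` and for every `k` if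
`γ > 4/3`. -/
theorem PressureLaw.exists_mul_rpow_le {p : ℝ → ℝ} {γ K : ℝ} (hp : PressureLaw p γ K) {k : ℝ}
    (hk : γ = 4 / 3 → k < K) : ∃ S : ℝ, 0 < S ∧ ∀ s, S ≤ s → k * s ^ (4 / 3 : ℝ) ≤ p s := by
  have hev : ∀ᶠ s in atTop, k ≤ p s / s ^ (4 / 3 : ℝ) := by
    rcases hp.four_thirds_le.eq_or_lt with h | h
    · have := hp.tendsto.eventually_const_lt (hk h.symm)
      rw [← h] at this
      exact this.mono fun s hs => hs.le
    · have hlim : Tendsto (fun s => p s / s ^ γ * s ^ (γ - 4 / 3)) atTop atTop :=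
        hp.tendsto.pos_mul_atTop hp.K_pos (tendsto_rpow_atTop (by linarith))
      filter_upwards [hlim.eventually_ge_atTop k, eventually_gt_atTop 0] with s hs hs0
      refine hs.trans_eq ?_
      rw [Real.rpow_sub hs0]
      field_simp
  obtain ⟨S, hS⟩ := eventually_atTop.1 (hev.and (eventually_gt_atTop 0))
  exact ⟨S, (hS S le_rfl).2, fun s hs =>
    (le_div_iff₀ (Real.rpow_pos_of_pos (hS s hs).2 _)).1 (hS s hs).1⟩

/-! ### The energy of admissible densities -/

/-- Only an inequality, as `newton` takes the value `0` where the integral defining it diverges. -/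
theorem ofReal_newton_le {ρ : Space → ℝ} (hρ : ∀ᵐ x : Space, 0 ≤ ρ x) (x : Space) :
    ENNReal.ofReal (newton ρ x)
      ≤ ∫⁻ y, ENNReal.ofReal (ρ y) * ENNReal.ofReal ‖x - y‖⁻¹ := by
  unfold newton
  by_cases h : Integrable fun y => ρ y / ‖x - y‖
  · rw [ofReal_integral_eq_lintegral_ofReal h
      (hρ.mono fun y hy => div_nonneg hy (norm_nonneg _))]
    refine le_of_eq (lintegral_congr fun y => ?_)
    rw [div_eq_mul_inv, ENNReal.ofReal_mul' (by positivity)]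
  · rw [integral_undef h]
    simp

theorem newton_nonneg {ρ : Space → ℝ} (hρ : ∀ᵐ x : Space, 0 ≤ ρ x) (x : Space) :
    0 ≤ newton ρ x :=
  integral_nonneg_of_ae (hρ.mono fun _ hy => div_nonneg hy (norm_nonneg _))

theorem aestronglyMeasurable_newton {ρ : Space → ℝ} (hρ : AEStronglyMeasurable ρ) :
    AEStronglyMeasurable (newton ρ) := by
  have h : AEStronglyMeasurable (fun z : Space × Space => ρ z.2 / ‖z.1 - z.2‖)
      (volume.prod volume) :=
    (hρ.comp_snd.aemeasurable.div (by fun_prop)).aestronglyMeasurable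
  exact h.integral_prod_right'

theorem integral_mul_newton_le {ρ : Space → ℝ} {M : ℝ} (hM : 0 < M)
    (hρ : ∀ᵐ x : Space, 0 ≤ ρ x) (hint : Integrable ρ) (hmass : ∫ x, ρ x = M)
    (hN : Integrable fun x => ρ x * newton ρ x)
    (hpow : Integrable fun x => ρ x ^ (4 / 3 : ℝ)) :
    ∫ x, ρ x * newton ρ x
      ≤ 2 * (2 * Real.pi + 1) * M ^ (2 / 3 : ℝ) * ∫ x, ρ x ^ (4 / 3 : ℝ) := by
  have hpi := Real.pi_pos
  have hpow0 : 0 ≤ᵐ[volume] fun x => ρ x ^ (4 / 3 : ℝ) :=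
    hρ.mono fun x hx => Real.rpow_nonneg hx _
  have hpow_int : 0 ≤ ∫ x, ρ x ^ (4 / 3 : ℝ) := integral_nonneg_of_ae hpow0
  have hm : ∫⁻ y, ENNReal.ofReal (ρ y) = ENNReal.ofReal M := by
    rw [← ofReal_integral_eq_lintegral_ofReal hint hρ, hmass]
  rw [← ENNReal.ofReal_le_ofReal_iff (by positivity), ENNReal.ofReal_mul (by positivity),
    ofReal_integral_eq_lintegral_ofReal hN
      (hρ.mono fun x hx => mul_nonneg hx (newton_nonneg hρ x)),
    ofReal_integral_eq_lintegral_ofReal hpow hpow0]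
  calc ∫⁻ x, ENNReal.ofReal (ρ x * newton ρ x)
      ≤ ∫⁻ x, ENNReal.ofReal (ρ x) * ∫⁻ y, ENNReal.ofReal (ρ y) * ENNReal.ofReal ‖x - y‖⁻¹ := by
        refine lintegral_mono fun x => ?_
        rw [ENNReal.ofReal_mul' (newton_nonneg hρ x)]
        gcongr
        exact ofReal_newton_le hρ x
    _ ≤ _ := lintegral_ofReal_mul_lintegral_inv_norm_sub_le hint.aemeasurable hM hm
    _ = _ := by
        congr 1
        refine lintegral_congr_ae (hρ.mono fun x hx => ?_)
        simp only [max_eq_left hx]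

theorem PressureLaw.aestronglyMeasurable_enthalpy {p : ℝ → ℝ} {γ K : ℝ} (hp : PressureLaw p γ K)
    {ρ : Space → ℝ} (hρ : ∀ᵐ x : Space, 0 ≤ ρ x) (hm : AEMeasurable ρ) :
    AEStronglyMeasurable fun x => enthalpy p (ρ x) := by
  have hmono : Monotone fun t => enthalpy p (max t 0) := fun s t hst =>
    hp.enthalpy_monotoneOn (le_max_right s 0) (le_max_right t 0) (max_le_max_right 0 hst)
  refine (hmono.measurable.comp_aemeasurable hm).aestronglyMeasurable.congr
    (hρ.mono fun x hx => ?_)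
  simp [max_eq_left hx]

theorem Admissible.rotDensity_nonneg {p L : ℝ → ℝ} {M : ℝ} {ρ : Space → ℝ}
    (h : Admissible p L M ρ) (hL : ∀ m : ℝ, 0 ≤ m → m ≤ M → 0 ≤ L m) :
    ∀ᵐ x, 0 ≤ rotDensity L ρ x := by
  filter_upwards [h.nonneg] with x hx
  refine div_nonneg (mul_nonneg hx (hL _ ?_ ?_)) (sq_nonneg _)
  · exact integral_nonneg_of_ae (ae_restrict_of_ae h.nonneg)
  · rw [← h.mass]
    exact setIntegral_le_integral h.integrable h.nonneg

/-- The three nonnegative terms whose sum has finite integral are integrable one by one. -/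
theorem Admissible.integrable_terms {p L : ℝ → ℝ} {γ K M : ℝ} {ρ : Space → ℝ}
    (hp : PressureLaw p γ K) (h : Admissible p L M ρ)
    (hL : ∀ m : ℝ, 0 ≤ m → m ≤ M → 0 ≤ L m) :
    Integrable (fun x => enthalpy p (ρ x)) ∧ Integrable (rotDensity L ρ) ∧
      Integrable fun x => ρ x * newton ρ x := by
  have hrot := h.rotDensity_nonneg hL
  have hA : Integrable fun x => enthalpy p (ρ x) := by
    refine h.finite_energy.mono'
      (hp.aestronglyMeasurable_enthalpy h.nonneg h.integrable.aemeasurable) ?_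
    filter_upwards [h.nonneg, hrot] with x hx hr
    rw [Real.norm_of_nonneg (hp.enthalpy_nonneg hx)]
    linarith [mul_nonneg hx (newton_nonneg h.nonneg x)]
  have hN : Integrable fun x => ρ x * newton ρ x := by
    refine h.finite_energy.mono' (h.integrable.aestronglyMeasurable.mul
      (aestronglyMeasurable_newton h.integrable.aestronglyMeasurable)) ?_
    filter_upwards [h.nonneg, hrot] with x hx hr
    rw [Real.norm_of_nonneg (mul_nonneg hx (newton_nonneg h.nonneg x))]
    linarith [hp.enthalpy_nonneg hx]
  refine ⟨hA, ?_, hN⟩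
  -- `L` need not be measurable: the rotational density is what remains of the total one.
  refine ((h.finite_energy.sub hA).sub hN).congr (Eventually.of_forall fun x => ?_)
  simp only [Pi.sub_apply]
  ring

/-- Half of the gravitational energy is at most `3k/2 ∫ ρ^(4/3)`, hence at most half of `∫ A(ρ)` plus
a constant, when the mass is small relative to `k`. -/
theorem Admissible.integral_positiveDensity_le {p L : ℝ → ℝ} {γ K M k S : ℝ} {ρ : Space → ℝ}
    (hp : PressureLaw p γ K) (h : Admissible p L M ρ) (hM : 0 < M)
    (hL : ∀ m : ℝ, 0 ≤ m → m ≤ M → 0 ≤ L m) (hk : 0 < k) (hS : 0 < S)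
    (hpk : ∀ s, S ≤ s → k * s ^ (4 / 3 : ℝ) ≤ p s)
    (hMk : 2 * (2 * Real.pi + 1) * M ^ (2 / 3 : ℝ) ≤ 3 * k) :
    Integrable (positiveDensity p L ρ) ∧ Integrable (energyDensity p L ρ) ∧
      ∫ x, positiveDensity p L ρ x
        ≤ 2 * energy p L ρ + 3 * k * S ^ (1 / 3 : ℝ) * M := by
  obtain ⟨hA, hR, hN⟩ := h.integrable_terms hp hL
  have hP : Integrable (positiveDensity p L ρ) := hA.add (hR.const_mul (1 / 2))
  have hE : Integrable (energyDensity p L ρ) := hP.sub (hN.const_mul (1 / 2))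
  refine ⟨hP, hE, ?_⟩
  have hlow : ∀ᵐ x, 3 * k * ρ x ^ (4 / 3 : ℝ)
      ≤ enthalpy p (ρ x) + 3 * k * S ^ (1 / 3 : ℝ) * ρ x :=
    h.nonneg.mono fun x hx => hp.le_enthalpy hk.le hS hpk hx
  have hdom : Integrable fun x => enthalpy p (ρ x) + 3 * k * S ^ (1 / 3 : ℝ) * ρ x :=
    hA.add (h.integrable.const_mul _)
  have hpow3 : Integrable fun x => 3 * k * ρ x ^ (4 / 3 : ℝ) := by
    refine hdom.mono' ((h.integrable.aemeasurable.pow_const _).const_mul _).aestronglyMeasurable ?_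
    filter_upwards [h.nonneg, hlow] with x hx hl
    rwa [Real.norm_of_nonneg (by positivity)]
  have hpow : Integrable fun x => ρ x ^ (4 / 3 : ℝ) :=
    (integrable_const_mul_iff (IsUnit.mk0 _ (by positivity)) _).1 hpow3
  have hpow_int : 0 ≤ ∫ x, ρ x ^ (4 / 3 : ℝ) :=
    integral_nonneg_of_ae (h.nonneg.mono fun x hx => Real.rpow_nonneg hx _)
  have hpow_le : 3 * k * ∫ x, ρ x ^ (4 / 3 : ℝ)
      ≤ (∫ x, enthalpy p (ρ x)) + 3 * k * S ^ (1 / 3 : ℝ) * M := by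
    have := integral_mono_ae hpow3 hdom hlow
    rwa [integral_const_mul, integral_add hA (h.integrable.const_mul _), integral_const_mul,
      h.mass] at this
  have hA_le : ∫ x, enthalpy p (ρ x) ≤ ∫ x, positiveDensity p L ρ x := by
    refine integral_mono_ae hA hP ((h.rotDensity_nonneg hL).mono fun x hx => ?_)
    simp only [positiveDensity]
    linarith
  have hF : energy p L ρ
      = (∫ x, positiveDensity p L ρ x) - 1 / 2 * ∫ x, ρ x * newton ρ x := by
    rw [← integral_const_mul, ← integral_sub hP (hN.const_mul _)]
    rfl
  have hnewton := (integral_mul_newton_le hM h.nonneg h.integrable h.mass hN hpow).trans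
    (mul_le_mul_of_nonneg_right hMk hpow_int)
  linarith

end RotatingStar

theorem theorem4p1 (p : ℝ → ℝ) (γ K : ℝ) (hp : RotatingStar.PressureLaw p γ K) :
    ∃ Mc : ENNReal,
      (γ = 4 / 3 → 0 < Mc ∧ Mc < ⊤) ∧
      (4 / 3 < γ → Mc = ⊤) ∧
      ∀ M : ℝ, 0 < M → ENNReal.ofReal M < Mc →
        ∀ L : ℝ → ℝ, (∀ m : ℝ, 0 ≤ m → m ≤ M → 0 ≤ L m) →
          ∃ C₁ C₂ : ℝ, 0 < C₁ ∧ 0 < C₂ ∧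
            ∀ ρ : RotatingStar.Space → ℝ, RotatingStar.Admissible p L M ρ →
              MeasureTheory.Integrable (RotatingStar.positiveDensity p L ρ) ∧
              MeasureTheory.Integrable (RotatingStar.energyDensity p L ρ) ∧
              ∫ x, RotatingStar.positiveDensity p L ρ x
                ≤ C₁ * RotatingStar.energy p L ρ + C₂ := by
  have hpi := Real.pi_pos
  have hK := hp.K_pos
  set c : ℝ := 2 * (2 * Real.pi + 1) with hc
  have hc0 : 0 < c := by positivity
  -- It suffices that `c * M ^ (2 / 3) ≤ 3 * k` for some `k` with `k * s ^ (4 / 3) ≤ p s` near `∞`.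
  have main : ∀ k : ℝ, 0 < k → (γ = 4 / 3 → k < K) → ∀ M : ℝ, 0 < M →
      c * M ^ (2 / 3 : ℝ) ≤ 3 * k →
      ∀ L : ℝ → ℝ, (∀ m : ℝ, 0 ≤ m → m ≤ M → 0 ≤ L m) →
        ∃ C₁ C₂ : ℝ, 0 < C₁ ∧ 0 < C₂ ∧
          ∀ ρ : RotatingStar.Space → ℝ, RotatingStar.Admissible p L M ρ →
            Integrable (RotatingStar.positiveDensity p L ρ) ∧
            Integrable (RotatingStar.energyDensity p L ρ) ∧
            ∫ x, RotatingStar.positiveDensity p L ρ x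
              ≤ C₁ * RotatingStar.energy p L ρ + C₂ := by
    intro k hk hkK M hM hMk L hL
    obtain ⟨S, hS, hpk⟩ := hp.exists_mul_rpow_le hkK
    exact ⟨2, 3 * k * S ^ (1 / 3 : ℝ) * M, two_pos, by positivity, fun ρ hρ =>
      hρ.integral_positiveDensity_le hp hM hL hk hS hpk hMk⟩
  rcases hp.four_thirds_le.eq_or_lt with hγ | hγ
  · -- Here `k = K / 2`, so `c * M ^ (2 / 3) ≤ 3 * k` reads `M ≤ (3 * (K / 2) / c) ^ (3 / 2)`.
    refine ⟨ENNReal.ofReal ((3 * (K / 2) / c) ^ (3 / 2 : ℝ)),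
      fun _ => ⟨ENNReal.ofReal_pos.2 (by positivity), ENNReal.ofReal_lt_top⟩,
      fun h => absurd hγ h.ne, fun M hM hMc => ?_⟩
    refine main (K / 2) (half_pos hK) (fun _ => half_lt_self hK) M hM ?_
    have hlt : M ≤ (3 * (K / 2) / c) ^ (3 / 2 : ℝ) :=
      ((ENNReal.ofReal_lt_ofReal_iff (by positivity)).1 hMc).le
    have := Real.rpow_le_rpow hM.le hlt (show (0 : ℝ) ≤ 2 / 3 by norm_num)
    rw [← Real.rpow_mul (by positivity), show (3 / 2 : ℝ) * (2 / 3) = 1 by norm_num,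
      Real.rpow_one, le_div_iff₀ hc0] at this
    linarith
  · refine ⟨⊤, fun h => absurd h hγ.ne', fun _ => rfl, fun M hM _ => ?_⟩
    exact main (c * M ^ (2 / 3 : ℝ) / 3) (by positivity) (fun h => absurd h hγ.ne') M hM
      (by linarith)
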